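/- Let $d\ge 0$ be an integer. Let $T(\mathbb{R}^d)$ be the real vector space with basis the words in the letters $1,\dots,d$, made into a commutative algebra by the shuffle product $\sqcup\!\sqcup$ (the shuffle $v\mathbin{\sqcup\!\sqcup}w$ of two words is the sum, with multiplicity, of all order-preserving interleavings of $v$ and $w$; the unit is the empty word). Let $A$ be the $d\times d$ matrix over this algebra whose $(i,j)$ entry is the two-letter word $ij$, let $\det\nolimits_{\sqcup\!\sqcup}(A)$ be its determinant, computed with the shuffle product, and let $\mathrm{inv}_d=\sum_{\rho\in S_d}\mathrm{sgn}(\rho)\,\rho(1)\rho(2)\cdots\rho(d)\in T(\mathbb{R}^d)$. Then $$2^d\det\nolimits_{\sqcup\!\sqcup}(A)=(\mathrm{inv}_d)^{\sqcup\!\sqcup\, 2}.$$ As a consequence, let $X\colon[0,1]\to\mathbb{R}^d$ be any continuous, piecewise continuously differentiable path (for instance a piecewise smooth one), that is, $X$ is continuously differentiable on each closed interval of some finite subdivision of $[0,1]$. Let $\sigma(X)$ be its signature, with coordinates $$\sigma(X)_{i_1\dots i_k}=\int_0^1\int_0^{t_k}\cdots\int_0^{t_2}\dot X_{i_1}(t_1)\cdots\dot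 X_{i_k}(t_k)\,dt_1\cdots dt_k$$ (equal to $1$ for the empty word), let $\sigma^{(2)}(X)=(\sigma(X)_{ij})_{i,j=1}^d$ be its second signature matrix, and let $\langle\sigma(X),\cdot\rangle\colon T(\mathbb{R}^d)\to\mathbb{R}$ be the linear map that sends a word $w$ to $\sigma(X)_w$. Then $$2^d\det\sigma^{(2)}(X)=\langle\sigma(X),\mathrm{inv}_d\rangle^2 .$$ In particular $\det\sigma^{(2)}(X)$ is the square of a real number, hence nonnegative. -/

import Mathlib

open scoped BigOperators

noncomputable section

/-- The underlying vector space of the shuffle algebra `T(ℝ^d)`: finite real linear combinations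
of words in the `d` letters `Fin d`. It is a type synonym, because its product is the
shuffle product. -/
def ShuffleAlgebra (d : ℕ) : Type := List (Fin d) →₀ ℝ

namespace ShuffleAlgebra

variable {d : ℕ}

instance : AddCommGroup (ShuffleAlgebra d) := inferInstanceAs (AddCommGroup (List (Fin d) →₀ ℝ))

instance : Module ℝ (ShuffleAlgebra d) := inferInstanceAs (Module ℝ (List (Fin d) →₀ ℝ))

/-- The words form a basis. -/
def basis (d : ℕ) : Module.Basis (List (Fin d)) ℝ (ShuffleAlgebra d) :=
  Module.Basis.ofRepr (LinearEquiv.refl ℝ (List (Fin d) →₀ ℝ))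

/-- A word as an element of the shuffle algebra. -/
def word (w : List (Fin d)) : ShuffleAlgebra d := basis d w

/-- The linear map that puts the letter `a` in front of every word. -/
def consLetter (a : Fin d) : ShuffleAlgebra d →ₗ[ℝ] ShuffleAlgebra d :=
  (basis d).constr ℝ fun w => word (a :: w)

/-- The linear map that puts the letter `a` behind every word. -/
def snocLetter (a : Fin d) : ShuffleAlgebra d →ₗ[ℝ] ShuffleAlgebra d :=
  (basis d).constr ℝ fun w => word (w ++ [a])

/-- The shuffle product of two words: the sum, with multiplicities, of all order-preserving
interleavings. The equivalent recursion on the last letters is `word_snoc_mul_word_snoc`. -/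
def shuffleWords : List (Fin d) → List (Fin d) → ShuffleAlgebra d
  | [], w => word w
  | a :: v, [] => word (a :: v)
  | a :: v, b :: w =>
      consLetter a (shuffleWords v (b :: w)) + consLetter b (shuffleWords (a :: v) w)
termination_by v w => v.length + w.length

/-- The bilinear extension of the shuffle product of words. -/
def shuffle : ShuffleAlgebra d →ₗ[ℝ] ShuffleAlgebra d →ₗ[ℝ] ShuffleAlgebra d :=
  (basis d).constr ℝ fun v => (basis d).constr ℝ fun w => shuffleWords v w

instance : Mul (ShuffleAlgebra d) := ⟨fun p q => shuffle p q⟩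

instance : One (ShuffleAlgebra d) := ⟨word []⟩

theorem mul_def (p q : ShuffleAlgebra d) : p * q = shuffle p q := rfl

theorem one_def : (1 : ShuffleAlgebra d) = word [] := rfl

@[simp] theorem consLetter_word (a : Fin d) (w : List (Fin d)) :
    consLetter a (word w) = word (a :: w) := by
  simp only [consLetter, word, Module.Basis.constr_basis]

@[simp] theorem snocLetter_word (a : Fin d) (w : List (Fin d)) :
    snocLetter a (word w) = word (w ++ [a]) := by
  simp only [snocLetter, word, Module.Basis.constr_basis]

theorem word_mul_word (v w : List (Fin d)) : word v * word w = shuffleWords v w := by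
  simp only [mul_def, shuffle, word, Module.Basis.constr_basis]

theorem induction_words {P : ShuffleAlgebra d → Prop} (p : ShuffleAlgebra d) (h0 : P 0)
    (hw : ∀ w, P (word w)) (hadd : ∀ p q, P p → P q → P (p + q))
    (hsmul : ∀ (c : ℝ) p, P p → P (c • p)) : P p := by
  have hp : p ∈ Submodule.span ℝ (Set.range (basis d)) := by
    rw [(basis d).span_eq]; trivial
  induction hp using Submodule.span_induction with
  | mem x hx => obtain ⟨w, rfl⟩ := hx; exact hw w
  | zero => exact h0
  | add x y _ _ hx hy => exact hadd x y hx hy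
  | smul c x _ hx => exact hsmul c x hx

theorem add_mul_aux (p q r : ShuffleAlgebra d) : (p + q) * r = p * r + q * r := by
  simp only [mul_def, map_add, LinearMap.add_apply]

theorem mul_add_aux (p q r : ShuffleAlgebra d) : p * (q + r) = p * q + p * r := by
  simp only [mul_def, map_add]

theorem smul_mul_aux (c : ℝ) (p q : ShuffleAlgebra d) : (c • p) * q = c • (p * q) := by
  simp only [mul_def, map_smul, LinearMap.smul_apply]

theorem mul_smul_aux (c : ℝ) (p q : ShuffleAlgebra d) : p * (c • q) = c • (p * q) := by
  simp only [mul_def, map_smul]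

theorem zero_mul_aux (p : ShuffleAlgebra d) : 0 * p = 0 := by
  simp only [mul_def, map_zero, LinearMap.zero_apply]

theorem mul_zero_aux (p : ShuffleAlgebra d) : p * 0 = 0 := by
  simp only [mul_def, map_zero]

theorem one_mul_aux (p : ShuffleAlgebra d) : 1 * p = p := by
  induction p using induction_words with
  | h0 => exact mul_zero_aux _
  | hw w => rw [one_def, word_mul_word, shuffleWords]
  | hadd p q hp hq => rw [mul_add_aux, hp, hq]
  | hsmul c p hp => rw [mul_smul_aux, hp]

theorem shuffleWords_nil (v : List (Fin d)) : shuffleWords v [] = word v := by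
  cases v <;> rw [shuffleWords]

theorem shuffleWords_comm (v w : List (Fin d)) : shuffleWords v w = shuffleWords w v := by
  match v, w with
  | [], [] => rfl
  | [], b :: w => simp only [shuffleWords]
  | a :: v, [] => simp only [shuffleWords]
  | a :: v, b :: w =>
    rw [shuffleWords, shuffleWords, shuffleWords_comm v (b :: w), shuffleWords_comm (a :: v) w,
      add_comm]
termination_by v.length + w.length

theorem mul_comm_aux (p q : ShuffleAlgebra d) : p * q = q * p := by
  induction p using induction_words with
  | h0 => rw [zero_mul_aux, mul_zero_aux]
  | hadd p p' hp hp' => rw [mul_add_aux, add_mul_aux, hp, hp']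
  | hsmul c p hp => rw [mul_smul_aux, smul_mul_aux, hp]
  | hw v =>
    induction q using induction_words with
    | h0 => rw [zero_mul_aux, mul_zero_aux]
    | hadd q q' hq hq' => rw [mul_add_aux, add_mul_aux, hq, hq']
    | hsmul c q hq => rw [mul_smul_aux, smul_mul_aux, hq]
    | hw w => rw [word_mul_word, word_mul_word, shuffleWords_comm]

/-- The recursion of the shuffle product on first letters. -/
theorem consLetter_mul_consLetter (a b : Fin d) (p q : ShuffleAlgebra d) :
    consLetter a p * consLetter b q =
      consLetter a (p * consLetter b q) + consLetter b (consLetter a p * q) := by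
  induction p using induction_words with
  | h0 => simp only [map_zero, zero_mul_aux, add_zero]
  | hadd p p' hp hp' => simp only [map_add, add_mul_aux, hp, hp']; abel
  | hsmul c p hp => simp only [map_smul, smul_mul_aux, hp, smul_add]
  | hw v =>
    induction q using induction_words with
    | h0 => simp only [map_zero, mul_zero_aux, add_zero]
    | hadd q q' hq hq' => simp only [map_add, mul_add_aux, hq, hq']; abel
    | hsmul c q hq => simp only [map_smul, mul_smul_aux, hq, smul_add]
    | hw w => simp only [consLetter_word, word_mul_word]; rw [shuffleWords]

theorem word_mul_assoc (u v w : List (Fin d)) :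
    word u * word v * word w = word u * (word v * word w) := by
  match u, v, w with
  | [], v, w => rw [← one_def, one_mul_aux, one_mul_aux]
  | a :: u, [], w => rw [← one_def, one_mul_aux, mul_comm_aux _ 1, one_mul_aux]
  | a :: u, b :: v, [] =>
    rw [← one_def, mul_comm_aux _ 1, mul_comm_aux _ 1, one_mul_aux, one_mul_aux]
  | a :: u, b :: v, c :: w =>
    have h1 := word_mul_assoc u (b :: v) (c :: w)
    have h2 := word_mul_assoc (a :: u) v (c :: w)
    have h3 := word_mul_assoc (a :: u) (b :: v) w
    simp only [← consLetter_word] at h1 h2 h3 ⊢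
    rw [consLetter_mul_consLetter a b] at h3 ⊢
    rw [consLetter_mul_consLetter b c] at h1 ⊢
    simp only [add_mul_aux, mul_add_aux] at h1 h3 ⊢
    rw [consLetter_mul_consLetter a c, consLetter_mul_consLetter b c,
      consLetter_mul_consLetter a b, consLetter_mul_consLetter a c, h1, h2]
    have h3' := congrArg (consLetter c) h3
    simp only [map_add] at h3' ⊢
    rw [← sub_eq_zero] at h3' ⊢
    rw [← h3']
    abel
termination_by u.length + v.length + w.length

theorem mul_assoc_aux (p q r : ShuffleAlgebra d) : p * q * r = p * (q * r) := by
  induction p using induction_words with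
  | h0 => simp only [zero_mul_aux]
  | hadd p p' hp hp' => simp only [add_mul_aux, hp, hp']
  | hsmul c p hp => simp only [smul_mul_aux, hp]
  | hw u =>
    induction q using induction_words with
    | h0 => simp only [zero_mul_aux, mul_zero_aux]
    | hadd p p' hp hp' => simp only [add_mul_aux, mul_add_aux, hp, hp']
    | hsmul c p hp => simp only [smul_mul_aux, mul_smul_aux, hp]
    | hw v =>
      induction r using induction_words with
      | h0 => simp only [mul_zero_aux]
      | hadd p p' hp hp' => simp only [mul_add_aux, hp, hp']
      | hsmul c p hp => simp only [mul_smul_aux, hp]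
      | hw w => exact word_mul_assoc u v w

/-- The shuffle algebra is commutative; its unit is the empty word. -/
instance : CommRing (ShuffleAlgebra d) :=
  { (inferInstance : AddCommGroup (ShuffleAlgebra d)) with
    mul := fun p q => p * q
    one := 1
    left_distrib := mul_add_aux
    right_distrib := add_mul_aux
    zero_mul := zero_mul_aux
    mul_zero := mul_zero_aux
    mul_assoc := mul_assoc_aux
    one_mul := one_mul_aux
    mul_one := fun p => by rw [mul_comm_aux, one_mul_aux]
    mul_comm := mul_comm_aux }

instance : Algebra ℝ (ShuffleAlgebra d) := Algebra.ofModule smul_mul_aux mul_smul_aux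

theorem snocLetter_consLetter (a b : Fin d) (p : ShuffleAlgebra d) :
    snocLetter a (consLetter b p) = consLetter b (snocLetter a p) := by
  induction p using induction_words with
  | h0 => simp only [map_zero]
  | hadd p q hp hq => simp only [map_add, hp, hq]
  | hsmul c p hp => simp only [map_smul, hp]
  | hw w => simp only [consLetter_word, snocLetter_word, List.cons_append]

/-- The recursion of the shuffle product on last letters:
`(v a) ⧢ (w b) = (v ⧢ (w b)) a + ((v a) ⧢ w) b`. -/
theorem word_snoc_mul_word_snoc (v w : List (Fin d)) (a b : Fin d) :
    word (v ++ [a]) * word (w ++ [b]) =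
      snocLetter a (word v * word (w ++ [b])) + snocLetter b (word (v ++ [a]) * word w) := by
  simp only [word_mul_word]
  match v, w with
  | [], [] => simp [shuffleWords, add_comm]
  | [], y :: w =>
    have h := word_snoc_mul_word_snoc [] w a b
    simp only [word_mul_word, List.nil_append] at h
    simp [shuffleWords, h, snocLetter_consLetter]
    abel
  | x :: v, [] =>
    have h := word_snoc_mul_word_snoc v [] a b
    simp only [word_mul_word, List.nil_append] at h
    simp [shuffleWords, shuffleWords_nil, h, snocLetter_consLetter]
    abel
  | x :: v, y :: w =>
    have h1 := word_snoc_mul_word_snoc v (y :: w) a b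
    have h2 := word_snoc_mul_word_snoc (x :: v) w a b
    simp only [word_mul_word, List.cons_append] at h1 h2
    simp [shuffleWords, h1, h2, snocLetter_consLetter]
    abel
termination_by v.length + w.length

/-- The `d × d` matrix whose `(i, j)` entry is the two-letter word `i j`. -/
def twoLetterMatrix (d : ℕ) : Matrix (Fin d) (Fin d) (ShuffleAlgebra d) :=
  Matrix.of fun i j => word [i, j]

/-- The element `inv_d = ∑ sgn(ρ) ρ(1)…ρ(d)`, summed over all permutations `ρ`. -/
def inv (d : ℕ) : ShuffleAlgebra d :=
  ∑ ρ : Equiv.Perm (Fin d), ((Equiv.Perm.sign ρ : ℤ) : ℝ) • word (List.ofFn fun i => ρ i)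

/-- The duality pairing `⟨T, p⟩` between a tensor series `T`, given by its coordinates `T w` for
all words `w`, and `p`: it is linear in `p` and `⟨T, w⟩ = T w`. -/
def pairing (T : List (Fin d) → ℝ) : ShuffleAlgebra d →ₗ[ℝ] ℝ := (basis d).constr ℝ T

end ShuffleAlgebra

namespace PathSignature

variable {d : ℕ}

/-- `X : [0,1] → ℝ^d` is a piecewise smooth path: it is continuous, and there is a subdivision
`0 = t 0 < ⋯ < t n = 1` such that `X` is continuously differentiable on every closed interval of
the subdivision (with one-sided derivatives at the ends). Once continuously differentiable is enough here, so
that paths with infinitely differentiable pieces are included. Only the values of `X` on `[0,1]`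
matter. -/
def IsPiecewiseSmooth (X : ℝ → Fin d → ℝ) : Prop :=
  ContinuousOn X (Set.Icc 0 1) ∧
    ∃ (n : ℕ) (t : Fin (n + 1) → ℝ), StrictMono t ∧ t 0 = 0 ∧ t (Fin.last n) = 1 ∧
      ∀ i : Fin n, ContDiffOn ℝ 1 X (Set.Icc (t i.castSucc) (t i.succ))

/-- Iterated integrals over `[0,t]`, for a word that is read from its last letter to its first:
the head of the list is the letter of the outermost integral. -/
def iteratedIntegral (X : ℝ → Fin d → ℝ) : List (Fin d) → ℝ → ℝ
  | [], _ => 1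
  | a :: w, t => ∫ s in (0 : ℝ)..t, iteratedIntegral X w s * deriv (fun r => X r a) s

/-- The signature of `X`; its coordinate at the word `i₁ … i_k` is
`∫_0^1 ∫_0^{t_k} ⋯ ∫_0^{t_2} X'_{i₁}(t₁) ⋯ X'_{i_k}(t_k) dt₁ ⋯ dt_k`. -/
def signature (X : ℝ → Fin d → ℝ) (w : List (Fin d)) : ℝ := iteratedIntegral X w.reverse 1

/-- The second signature, as a `d × d` matrix. -/
def signatureMatrix (X : ℝ → Fin d → ℝ) : Matrix (Fin d) (Fin d) ℝ :=
  Matrix.of fun i j => signature X [i, j]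

end PathSignature

end

/-!
Write `C` for twice the matrix of two-letter words and `g` for the alternating sum of all
permutations of the letters; the claim is `det C = g ^ 2`. The map that removes a given first letter
is a derivation of the shuffle algebra (`ShuffleAlgebra.removeFirst`), and an element is determined
by its constant term and its first-letter derivatives. Two facts follow.

* The shuffle algebra is an integral domain. Derivations preserve nilpotency, so the algebra is
  reduced; and if `p * q = 0`, then `p ^ 2` annihilates all derivatives of `q`, which are shorter.
* The row vector `u` of signed alternating sums with one letter omitted satisfies `u C = g v`, where
  `v` is the vector of letters (`ShuffleAlgebra.sum_word_pair_mul_alternant`). Both sides have the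
  same derivatives, by induction on the number of letters.

Let `D` be the derivation for the letter `0`, and `e₀` the first unit row vector. Then `D g = u₀`
and `D (u C) = (D u) C + 2 u₀ v`, so `(D u) C = g e₀ - u₀ v`. Multiplying the two relations by the
adjugate and taking the coordinate `0`, where `D u₀ = 0`, gives `u₀ det C = g (v adj C)₀` and
`u₀ (v adj C)₀ = g (adj C)₀₀`. By induction on the number of letters the principal cofactor
`(adj C)₀₀` is `u₀ ^ 2`. As `u₀ ≠ 0`, cancelling in the domain yields `det C = g ^ 2`
(`ShuffleAlgebra.det_twoWordMatrix`).

The statement on paths follows because pairing with the signature is a homomorphism of algebras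
(`PathSignature.IsPiecewiseSmooth.signatureHom`). On words this is integration by parts for iterated
integrals, which applies because they are continuous on `[0, 1]`, differentiable off the finitely
many break points, and have integrable derivatives.
-/

noncomputable section

/-! ### First-letter derivations -/

namespace ShuffleAlgebra

variable {d : ℕ}

/-- The linear map underlying `removeFirst a`. -/
def removeFirstLinear (a : Fin d) : ShuffleAlgebra d →ₗ[ℝ] ShuffleAlgebra d :=
  (basis d).constr ℝ fun w =>
    match w with
    | [] => 0
    | b :: w => if b = a then word w else 0

theorem removeFirstLinear_one (a : Fin d) : removeFirstLinear a 1 = 0 := by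
  rw [one_def, removeFirstLinear, word, Module.Basis.constr_basis]

theorem removeFirstLinear_consLetter (a b : Fin d) (p : ShuffleAlgebra d) :
    removeFirstLinear a (consLetter b p) = if b = a then p else 0 := by
  induction p using induction_words with
  | h0 => simp
  | hadd p q hp hq => simp only [map_add, hp, hq]; split_ifs <;> simp
  | hsmul c p hp => simp only [map_smul, hp]; split_ifs <;> simp
  | hw w => rw [consLetter_word, removeFirstLinear, word, Module.Basis.constr_basis]

theorem removeFirstLinear_mul (a : Fin d) (p q : ShuffleAlgebra d) :
    removeFirstLinear a (p * q) = p * removeFirstLinear a q + q * removeFirstLinear a p := by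
  induction p using induction_words with
  | h0 => simp
  | hadd p p' hp hp' => simp only [map_add, add_mul, mul_add, hp, hp']; abel
  | hsmul c p hp => simp only [map_smul, smul_mul_assoc, mul_smul_comm, smul_add, hp]
  | hw v =>
    induction q using induction_words with
    | h0 => simp
    | hadd q q' hq hq' => simp only [map_add, add_mul, mul_add, hq, hq']; abel
    | hsmul c q hq => simp only [map_smul, smul_mul_assoc, mul_smul_comm, smul_add, hq]
    | hw w =>
      match v, w with
      | [], w => simp [← one_def, removeFirstLinear_one]
      | v, [] => simp [← one_def, removeFirstLinear_one]
      | b :: v, c :: w =>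
        simp only [← consLetter_word, consLetter_mul_consLetter, map_add,
          removeFirstLinear_consLetter]
        split_ifs <;> simp [mul_comm, add_comm]

/-- The derivation of the shuffle algebra that removes the first letter of a word if it is `a`, and
sends every other word to `0`. -/
def removeFirst (a : Fin d) : Derivation ℝ (ShuffleAlgebra d) (ShuffleAlgebra d) where
  toLinearMap := removeFirstLinear a
  map_one_eq_zero' := removeFirstLinear_one a
  leibniz' := removeFirstLinear_mul a

theorem removeFirst_consLetter (a b : Fin d) (p : ShuffleAlgebra d) :
    removeFirst a (consLetter b p) = if b = a then p else 0 :=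
  removeFirstLinear_consLetter a b p

theorem removeFirst_word_cons (a b : Fin d) (w : List (Fin d)) :
    removeFirst a (word (b :: w)) = if b = a then word w else 0 := by
  rw [← consLetter_word, removeFirst_consLetter]

/-- The coefficient of the empty word. -/
def emptyCoeff (d : ℕ) : ShuffleAlgebra d →ₗ[ℝ] ℝ := (basis d).coord []

theorem emptyCoeff_word (w : List (Fin d)) : emptyCoeff d (word w) = if w = [] then 1 else 0 := by
  simp [emptyCoeff, word, Finsupp.single_apply]

theorem emptyCoeff_one : emptyCoeff d 1 = 1 := by simp [one_def, emptyCoeff_word]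

theorem emptyCoeff_consLetter (a : Fin d) (p : ShuffleAlgebra d) :
    emptyCoeff d (consLetter a p) = 0 := by
  induction p using induction_words with
  | h0 => simp
  | hadd p q hp hq => simp [hp, hq]
  | hsmul c p hp => simp [hp]
  | hw w => simp [emptyCoeff_word]

theorem emptyCoeff_consLetter_mul (a : Fin d) (p q : ShuffleAlgebra d) :
    emptyCoeff d (consLetter a p * q) = 0 := by
  induction q using induction_words with
  | h0 => simp
  | hadd q q' hq hq' => simp [mul_add, hq, hq']
  | hsmul c q hq => simp [hq]
  | hw w =>
    match w with
    | [] => rw [← one_def, mul_one, emptyCoeff_consLetter]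
    | b :: w =>
      rw [← consLetter_word, consLetter_mul_consLetter, map_add, emptyCoeff_consLetter,
        emptyCoeff_consLetter, add_zero]

/-- An element is determined by its constant term and its first-letter derivatives. -/
theorem eq_emptyCoeff_smul_add_sum (p : ShuffleAlgebra d) :
    p = emptyCoeff d p • 1 + ∑ a, consLetter a (removeFirst a p) := by
  induction p using induction_words with
  | h0 => simp
  | hadd p q hp hq =>
    conv_lhs => rw [hp, hq]
    simp only [map_add, Finset.sum_add_distrib, add_smul]
    abel
  | hsmul c p hp =>
    conv_lhs => rw [hp]
    simp only [map_smul, Derivation.map_smul, ← Finset.smul_sum, smul_add, smul_smul, smul_eq_mul]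
  | hw w =>
    match w with
    | [] => simp [← one_def, emptyCoeff_one]
    | b :: w => simp [emptyCoeff_word, removeFirst_word_cons, apply_ite]

theorem eq_emptyCoeff_smul_one {p : ShuffleAlgebra d} (h : ∀ a, removeFirst a p = 0) :
    p = emptyCoeff d p • 1 := by
  conv_lhs => rw [eq_emptyCoeff_smul_add_sum p]
  simp [h]

theorem eq_zero_of_removeFirst {p : ShuffleAlgebra d} (h0 : emptyCoeff d p = 0)
    (h : ∀ a, removeFirst a p = 0) : p = 0 := by
  rw [eq_emptyCoeff_smul_one h, h0, zero_smul]

instance : Nontrivial (ShuffleAlgebra d) :=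
  ⟨⟨1, 0, fun h => by simpa [emptyCoeff_one] using congrArg (emptyCoeff d) h⟩⟩

/-! ### The shuffle algebra is a domain -/

/-- `LengthLT n p` says that all words occurring in `p` have length less than `n`. It is encoded by
recursion on `n`: all first-letter derivatives of `p` have words of length less than `n - 1`. -/
def LengthLT : ℕ → ShuffleAlgebra d → Prop
  | 0, p => p = 0
  | n + 1, p => ∀ a, LengthLT n (removeFirst a p)

theorem LengthLT.zero (n : ℕ) : LengthLT n (0 : ShuffleAlgebra d) := by
  induction n with
  | zero => rfl
  | succ n ih => intro a; simpa using ih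

theorem LengthLT.add {n : ℕ} {p q : ShuffleAlgebra d} (hp : LengthLT n p) (hq : LengthLT n q) :
    LengthLT n (p + q) := by
  induction n generalizing p q with
  | zero => simp_all [LengthLT]
  | succ n ih => intro a; simpa using ih (hp a) (hq a)

theorem LengthLT.smul {n : ℕ} {p : ShuffleAlgebra d} (c : ℝ) (hp : LengthLT n p) :
    LengthLT n (c • p) := by
  induction n generalizing p with
  | zero => simp_all [LengthLT]
  | succ n ih => intro a; simpa using ih (hp a)

theorem LengthLT.succ {n : ℕ} {p : ShuffleAlgebra d} (hp : LengthLT n p) : LengthLT (n + 1) p := by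
  induction n generalizing p with
  | zero => intro a; simp_all [LengthLT]
  | succ n ih => exact fun a => ih (hp a)

theorem LengthLT.mono {m n : ℕ} (h : m ≤ n) {p : ShuffleAlgebra d} (hp : LengthLT m p) :
    LengthLT n p := by
  induction h with
  | refl => exact hp
  | step _ ih => exact ih.succ

theorem LengthLT.word (w : List (Fin d)) : LengthLT (w.length + 1) (word w) := by
  induction w with
  | nil => intro a; simp [← one_def, LengthLT.zero]
  | cons b w ih =>
    intro a
    rw [removeFirst_word_cons]
    split_ifs
    exacts [ih, LengthLT.zero _]

theorem exists_lengthLT (p : ShuffleAlgebra d) : ∃ n, LengthLT n p := by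
  induction p using induction_words with
  | h0 => exact ⟨0, rfl⟩
  | hadd p q hp hq =>
    obtain ⟨m, hm⟩ := hp
    obtain ⟨n, hn⟩ := hq
    exact ⟨max m n, (hm.mono (le_max_left _ _)).add (hn.mono (le_max_right _ _))⟩
  | hsmul c p hp => exact hp.imp fun n hn => hn.smul c
  | hw w => exact ⟨_, LengthLT.word w⟩

end ShuffleAlgebra

/-- In characteristic zero a derivation maps nilpotent elements to nilpotent elements. -/
theorem Derivation.isNilpotent_apply {K R : Type*} [Field K] [CharZero K] [CommRing R] [Algebra K R]
    (D : Derivation K R R) {p : R} (hp : IsNilpotent p) : IsNilpotent (D p) := by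
  obtain ⟨n, hn⟩ := hp
  -- Differentiating `p ^ (m + 1) * (D p) ^ j = 0` and multiplying by `D p` trades one factor `p`
  -- for two factors `D p`.
  have key : ∀ m j : ℕ, p ^ m * D p ^ j = 0 → IsNilpotent (D p) := by
    intro m
    induction m with
    | zero => exact fun j h => ⟨j, by simpa using h⟩
    | succ m ih =>
      intro j h
      refine ih (j + 2) ?_
      have h1 := congrArg (fun x => D p * D x) h
      simp only [Derivation.leibniz, Derivation.leibniz_pow, map_zero, mul_zero, smul_eq_mul,
        nsmul_eq_mul, add_tsub_cancel_right] at h1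
      have h2 : ((m + 1 : ℕ) : K) • (p ^ m * D p ^ (j + 2)) = 0 := by
        have h3 : D p * (p ^ (m + 1) * ((j : R) * (D p ^ (j - 1) * D (D p)))) = 0 := by
          cases j with
          | zero => simp
          | succ j =>
            calc _ = (p ^ (m + 1) * D p ^ (j + 1)) * (((j + 1 : ℕ) : R) * D (D p)) := by
                  rw [Nat.add_sub_cancel]; ring
              _ = 0 := by rw [h, zero_mul]
        rw [mul_add, h3, zero_add] at h1
        rw [Algebra.smul_def, _root_.map_natCast, ← h1]
        ring
      exact (smul_eq_zero.1 h2).resolve_left (by exact_mod_cast m.succ_ne_zero)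
  exact key n 0 (by simpa using hn)

namespace ShuffleAlgebra

variable {d : ℕ}

/-- Induction on the length: the derivatives of a nilpotent element are nilpotent, so they vanish,
and the element is a constant. -/
instance : IsReduced (ShuffleAlgebra d) where
  eq_zero p hp := by
    obtain ⟨n, hn⟩ := exists_lengthLT p
    induction n generalizing p with
    | zero => exact hn
    | succ n ih =>
      have hc := eq_emptyCoeff_smul_one fun a =>
        ih _ ((removeFirst a).isNilpotent_apply hp) (hn a)
      obtain ⟨k, hk⟩ := hp
      rw [hc, smul_pow, one_pow] at hk
      rw [hc, eq_zero_of_pow_eq_zero ((smul_eq_zero.1 hk).resolve_right one_ne_zero), zero_smul]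

/-- Induction on the length of the second factor: if `p * q = 0`, then `p ^ 2` annihilates every
derivative of `q`. -/
instance : NoZeroDivisors (ShuffleAlgebra d) where
  eq_zero_or_eq_zero_of_mul_eq_zero := by
    intro p q hpq
    obtain ⟨n, hn⟩ := exists_lengthLT q
    induction n generalizing p q with
    | zero => exact Or.inr hn
    | succ n ih =>
      refine or_iff_not_imp_left.2 fun hp => ?_
      have hq : ∀ a, removeFirst a q = 0 := fun a => by
        refine (ih (p := p ^ 2) ?_ (hn a)).resolve_left (pow_ne_zero 2 hp)
        have h := congrArg (fun x => p * removeFirst a x) hpq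
        simp only [Derivation.leibniz, map_zero, mul_zero, smul_eq_mul] at h
        linear_combination h - removeFirst a p * hpq
      have hc := eq_emptyCoeff_smul_one hq
      rw [hc, mul_smul_comm, mul_one] at hpq
      rw [hc, (smul_eq_zero.1 hpq).resolve_right hp, zero_smul]

instance : IsDomain (ShuffleAlgebra d) := NoZeroDivisors.to_isDomain _

end ShuffleAlgebra

/-! ### Alternating sums of words -/

/-- Removing two entries of a tuple in either order changes the sign of the alternating sum. -/
theorem Fin.sum_sum_neg_one_pow_succAbove_swap {α M : Type*} [AddCommGroup M] [Module ℝ M] {n : ℕ}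
    (G : α → α → (Fin n → α) → M) (y : Fin (n + 2) → α) :
    ∑ k : Fin (n + 2), ∑ l : Fin (n + 1), (-1 : ℝ) ^ (k + l : ℕ) •
        G (y k) (y (k.succAbove l)) (y ∘ k.succAbove ∘ l.succAbove) =
      -∑ k : Fin (n + 2), ∑ l : Fin (n + 1), (-1 : ℝ) ^ (k + l : ℕ) •
        G (y (k.succAbove l)) (y k) (y ∘ k.succAbove ∘ l.succAbove) := by
  simp only [← Finset.sum_neg_distrib]
  rw [← Fintype.sum_prod_type', ← Fintype.sum_prod_type']
  have hinv : Function.Involutive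
      (fun p : Fin (n + 2) × Fin (n + 1) => (p.1.succAbove p.2, p.2.predAbove p.1)) := fun p => by
    ext1
    · exact Fin.succAbove_succAbove_predAbove _ _
    · exact Fin.predAbove_predAbove_succAbove _ _
  refine Fintype.sum_equiv hinv.toPerm _ _ fun p => ?_
  have hcomp : y ∘ (p.1.succAbove p.2).succAbove ∘ (p.2.predAbove p.1).succAbove =
      y ∘ p.1.succAbove ∘ p.2.succAbove :=
    funext fun k => congrArg y (Fin.succAbove_succAbove_succAbove_predAbove _ _ _)
  simp only [Function.Involutive.coe_toPerm, Fin.neg_one_pow_succAbove_add_predAbove,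
    Fin.succAbove_succAbove_predAbove, hcomp, neg_smul, neg_neg]

namespace ShuffleAlgebra

variable {d n : ℕ}

/-- The alternating sum of the words obtained by permuting the letters `y 0, …, y (n - 1)`. The
coefficient of a word `w` is written as the determinant of the matrix of the `δ (w i) (y j)`, so
that the properties of alternating sums are properties of determinants. -/
def alternant (y : Fin n → Fin d) : ShuffleAlgebra d :=
  ∑ w : Fin n → Fin d,
    (Matrix.of fun i j => if w i = y j then (1 : ℝ) else 0).det • word (List.ofFn w)

theorem alternant_zero (y : Fin 0 → Fin d) : alternant y = 1 := by
  simp [alternant, one_def]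

theorem alternant_eq_zero {y : Fin n → Fin d} {i j : Fin n} (hij : i ≠ j) (h : y i = y j) :
    alternant y = 0 := by
  refine Finset.sum_eq_zero fun w _ => ?_
  rw [Matrix.det_zero_of_column_eq hij fun k => by simp [h], zero_smul]

theorem alternant_eq_sum_perm (y : Fin n → Fin d) :
    alternant y =
      ∑ ρ : Equiv.Perm (Fin n), ((Equiv.Perm.sign ρ : ℤ) : ℝ) • word (List.ofFn (y ∘ ρ)) := by
  simp only [alternant, ← Matrix.det_transpose (Matrix.of _), Matrix.det_apply', Finset.sum_smul]
  rw [Finset.sum_comm]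
  refine Finset.sum_congr rfl fun ρ _ => ?_
  rw [Finset.sum_eq_single (y ∘ ρ)]
  · simp
  · intro w _ hw
    obtain ⟨i, hi⟩ := Function.ne_iff.1 hw
    rw [Finset.prod_eq_zero (Finset.mem_univ i), mul_zero, zero_smul]
    simpa using hi
  · simp

theorem emptyCoeff_alternant_succ (y : Fin (n + 1) → Fin d) : emptyCoeff d (alternant y) = 0 := by
  simp [alternant, emptyCoeff_word]

/-- The derivative of an alternating sum is the expansion of the determinants along their first
row. -/
theorem removeFirst_alternant (b : Fin d) (y : Fin (n + 1) → Fin d) :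
    removeFirst b (alternant y) =
      ∑ k : Fin (n + 1), (-1 : ℝ) ^ (k : ℕ) •
        if b = y k then alternant (y ∘ k.succAbove) else 0 := by
  rw [alternant, map_sum, ← (Fin.consEquiv fun _ => Fin d).sum_comp, Fintype.sum_prod_type,
    Finset.sum_eq_single b]
  · have hcons (w : Fin n → Fin d) : removeFirst b
        ((Matrix.of fun i j => if (Fin.cons b w : Fin (n + 1) → Fin d) i = y j
          then (1 : ℝ) else 0).det • word (List.ofFn (Fin.cons b w : Fin (n + 1) → Fin d))) =
        ∑ k : Fin (n + 1), ((-1 : ℝ) ^ (k : ℕ) * (if b = y k then 1 else 0) *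
          (Matrix.of fun i j => if w i = y (k.succAbove j) then (1 : ℝ) else 0).det) •
            word (List.ofFn w) := by
      rw [Derivation.map_smul, List.ofFn_cons, removeFirst_word_cons, if_pos rfl,
        Matrix.det_succ_row_zero, Finset.sum_smul]
      rfl
    refine (Finset.sum_congr rfl fun w _ => hcons w).trans ?_
    rw [Finset.sum_comm]
    refine Finset.sum_congr rfl fun k _ => ?_
    split_ifs
    · simp only [alternant, Finset.smul_sum, smul_smul]
      refine Finset.sum_congr rfl fun w _ => ?_
      simp
    · simp
  · intro a _ hab
    simp [removeFirst_word_cons, hab]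
  · simp

theorem removeFirst_alternant_cons (b i : Fin d) (y : Fin (n + 1) → Fin d) :
    removeFirst b (alternant (Fin.cons i y : Fin (n + 2) → Fin d)) =
      (if b = i then alternant y else 0) -
        ∑ k : Fin (n + 1), (-1 : ℝ) ^ (k : ℕ) •
          if b = y k then alternant (Fin.cons i (y ∘ k.succAbove) : Fin (n + 1) → Fin d)
          else 0 := by
  rw [removeFirst_alternant, Fin.sum_univ_succ, sub_eq_add_neg, ← Finset.sum_neg_distrib]
  congr 1
  · simp [Function.comp_def]
  · refine Finset.sum_congr rfl fun k _ => ?_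
    rw [Fin.cons_comp_succ_succAbove, Fin.cons_succ,
      show k.removeNth y = y ∘ k.succAbove from rfl]
    split_ifs <;> simp [pow_succ]

theorem removeFirst_word_pair_mul (a b i : Fin d) (p : ShuffleAlgebra d) :
    removeFirst b (word [a, i] * p) =
      (if b = a then word [i] * p else 0) + word [a, i] * removeFirst b p := by
  rw [Derivation.leibniz, removeFirst_word_cons, add_comm]
  by_cases h : b = a
  · simp [h, mul_comm]
  · simp [h, Ne.symm h]

theorem removeFirst_letter_mul (b i : Fin d) (p : ShuffleAlgebra d) :
    removeFirst b (word [i] * p) = (if b = i then p else 0) + word [i] * removeFirst b p := by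
  rw [Derivation.leibniz, removeFirst_word_cons, add_comm]
  by_cases h : b = i
  · simp [h, ← one_def]
  · simp [h, Ne.symm h]

/-- The linear relation between the two-letter words and the alternating sums. It is proved by
induction on the number of letters, comparing the first-letter derivatives of both sides. -/
theorem sum_word_pair_mul_alternant {n : ℕ} (i : Fin d) (y : Fin (n + 1) → Fin d) :
    ∑ k : Fin (n + 1), (-1 : ℝ) ^ (k : ℕ) •
        ((2 : ℝ) • (word [y k, i] * alternant (y ∘ k.succAbove))) =
      word [i] * alternant y - alternant (Fin.cons i y : Fin (n + 2) → Fin d) := by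
  rw [← sub_eq_zero]
  refine eq_zero_of_removeFirst ?_ fun b => ?_
  · simp only [← consLetter_word, map_sub, map_sum, map_smul, emptyCoeff_consLetter_mul,
      emptyCoeff_alternant_succ]
    simp
  · rw [map_sub, map_sub, removeFirst_letter_mul, removeFirst_alternant_cons, removeFirst_alternant,
      add_sub_sub_cancel, map_sum]
    simp only [Derivation.map_smul, removeFirst_word_pair_mul, smul_add, Finset.sum_add_distrib]
    have key : ∑ k : Fin (n + 1), (-1 : ℝ) ^ (k : ℕ) •
        (2 : ℝ) • (word [y k, i] * removeFirst b (alternant (y ∘ k.succAbove))) =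
        -∑ k : Fin (n + 1), (-1 : ℝ) ^ (k : ℕ) • if b = y k then
          word [i] * alternant (y ∘ k.succAbove) -
            alternant (Fin.cons i (y ∘ k.succAbove) : Fin (n + 1) → Fin d) else 0 := by
      cases n with
      | zero =>
        have h (z : Fin 0 → Fin d) : alternant (Fin.cons i z : Fin 1 → Fin d) = word [i] := by
          simp [alternant_eq_sum_perm]
        simp [alternant_zero, h]
      | succ n =>
        have h := Fin.sum_sum_neg_one_pow_succAbove_swap
          (fun u v z => if b = v then (2 : ℝ) • (word [u, i] * alternant z) else 0) y
        convert h using 1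
        · refine Finset.sum_congr rfl fun k _ => ?_
          rw [removeFirst_alternant, Finset.mul_sum, Finset.smul_sum, Finset.smul_sum]
          refine Finset.sum_congr rfl fun l _ => ?_
          by_cases hb : b = y (k.succAbove l)
          · simp only [Function.comp_apply, hb, if_true, mul_smul_comm, pow_add, mul_smul,
              Function.comp_assoc]
            rw [smul_comm (2 : ℝ)]
          · simp [hb]
        · congr 1
          refine Finset.sum_congr rfl fun k _ => ?_
          by_cases hb : b = y k
          · simp only [hb, if_true, pow_add, mul_smul, ← Finset.smul_sum]
            rw [← sum_word_pair_mul_alternant i (y ∘ k.succAbove)]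
            rfl
          · simp [hb]
    rw [key, Finset.mul_sum]
    simp only [← Finset.sum_neg_distrib, ← Finset.sum_add_distrib, ← Finset.sum_sub_distrib]
    refine Finset.sum_eq_zero fun k _ => ?_
    by_cases hb : b = y k
    · simp only [hb, if_true, mul_smul_comm]
      module
    · simp [hb]

termination_by n

end ShuffleAlgebra

/-! ### The determinant identity -/

namespace ShuffleAlgebra

variable {d n : ℕ}

theorem removeFirst_alternant_apply_zero {x : Fin (n + 1) → Fin d} (hx : Function.Injective x) :
    removeFirst (x 0) (alternant x) = alternant (x ∘ Fin.succ) := by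
  rw [removeFirst_alternant, Finset.sum_eq_single 0]
  · simp [Fin.succAbove_zero]
  · intro k _ hk
    rw [if_neg fun h => hk (hx h).symm, smul_zero]
  · simp

theorem removeFirst_alternant_of_forall_ne {b : Fin d} {x : Fin n → Fin d} (hb : ∀ k, b ≠ x k) :
    removeFirst b (alternant x) = 0 := by
  cases n with
  | zero => simp [alternant_zero]
  | succ n => simp [removeFirst_alternant, hb]

theorem alternant_ne_zero {x : Fin n → Fin d} (hx : Function.Injective x) : alternant x ≠ 0 := by
  induction n with
  | zero => simp [alternant_zero]
  | succ n ih =>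
    intro h
    apply ih (hx.comp (Fin.succ_injective n))
    rw [← removeFirst_alternant_apply_zero hx, h, map_zero]

/-- Twice the matrix of two-letter words in the letters `x 0, …, x (n - 1)`. -/
def twoWordMatrix (x : Fin n → Fin d) : Matrix (Fin n) (Fin n) (ShuffleAlgebra d) :=
  Matrix.of fun i j => (2 : ℝ) • word [x i, x j]

/-- The alternating sums with one letter omitted, with the signs of a cofactor expansion. -/
def signedAlternant (x : Fin (n + 1) → Fin d) (k : Fin (n + 1)) : ShuffleAlgebra d :=
  (-1 : ℝ) ^ (k : ℕ) • alternant (x ∘ k.succAbove)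

theorem signedAlternant_vecMul (x : Fin (n + 1) → Fin d) (j : Fin (n + 1)) :
    ∑ k, signedAlternant x k * twoWordMatrix x k j = word [x j] * alternant x := by
  -- The letter `x j` occurs twice in the tuple `Fin.cons (x j) x`, so its alternating sum is zero.
  have h := sum_word_pair_mul_alternant (x j) x
  rw [alternant_eq_zero (y := Fin.cons (x j) x) (Fin.succ_ne_zero j).symm (by simp), sub_zero] at h
  rw [← h]
  refine Finset.sum_congr rfl fun k _ => ?_
  simp only [signedAlternant, twoWordMatrix, Matrix.of_apply, smul_mul_assoc, mul_smul_comm,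
    mul_comm (alternant _)]
  rw [smul_comm]

theorem removeFirst_signedAlternant_vecMul {x : Fin (n + 1) → Fin d} (hx : Function.Injective x)
    (j : Fin (n + 1)) :
    ∑ k, removeFirst (x 0) (signedAlternant x k) * twoWordMatrix x k j =
      (if j = 0 then alternant x else 0) - signedAlternant x 0 * word [x j] := by
  have h := congrArg (removeFirst (x 0)) (signedAlternant_vecMul x j)
  have h0 : signedAlternant x 0 = removeFirst (x 0) (alternant x) := by
    simp [signedAlternant, removeFirst_alternant_apply_zero hx, Fin.succAbove_zero]
  have h1 : ∑ k, signedAlternant x k * removeFirst (x 0) (twoWordMatrix x k j) =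
      2 * (signedAlternant x 0 * word [x j]) := by
    rw [Finset.sum_eq_single 0]
    · simp [twoWordMatrix, removeFirst_word_cons, two_smul, two_mul, mul_add]
    · intro k _ hk
      simp [twoWordMatrix, removeFirst_word_cons, hx.ne hk]
    · simp
  simp only [map_sum, Derivation.leibniz, smul_eq_mul, Finset.sum_add_distrib, h1] at h
  have h2 : removeFirst (x 0) (word [x j]) = if j = 0 then (1 : ShuffleAlgebra d) else 0 := by
    simp [removeFirst_word_cons, hx.eq_iff, one_def]
  rw [h2, ← h0] at h
  have h3 : alternant x * (if j = 0 then (1 : ShuffleAlgebra d) else 0) =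
      if j = 0 then alternant x else 0 := by simp
  rw [h3] at h
  simp only [mul_comm (removeFirst _ (signedAlternant x _))]
  linear_combination h

/-- Induction on the number of letters. Multiplying the linear relations
`signedAlternant_vecMul` and `removeFirst_signedAlternant_vecMul` by the adjugate matrix expresses
the determinant by the principal cofactor at `0`, which is the square of an alternating sum. -/
theorem det_twoWordMatrix {x : Fin n → Fin d} (hx : Function.Injective x) :
    (twoWordMatrix x).det = alternant x ^ 2 := by
  induction n with
  | zero => simp [alternant_zero]
  | succ n ih =>
    set M := twoWordMatrix x
    set g := alternant x
    set u := signedAlternant x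
    set v : Fin (n + 1) → ShuffleAlgebra d := fun j => word [x j]
    have hu : u 0 = alternant (x ∘ Fin.succ) := by
      simp [u, signedAlternant, Fin.succAbove_zero]
    have hu0 : u 0 ≠ 0 := hu ▸ alternant_ne_zero (hx.comp (Fin.succ_injective n))
    have hadj : M.adjugate 0 0 = u 0 ^ 2 := by
      rw [Matrix.adjugate_fin_succ_eq_det_submatrix, hu, ← ih (hx.comp (Fin.succ_injective n))]
      simp [Fin.succAbove_zero]
      rfl
    have hmul (p q : Fin (n + 1) → ShuffleAlgebra d) (h : ∀ j, ∑ k, p k * M k j = q j) :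
        p 0 * M.det = ∑ j, q j * M.adjugate j 0 := by
      have h' : Matrix.vecMul p M = q := funext h
      have := congrFun (congrArg (fun r => Matrix.vecMul r M.adjugate) h') 0
      change p 0 * M.det = Matrix.vecMul q M.adjugate 0
      simpa [Matrix.vecMul_vecMul, Matrix.mul_adjugate, Matrix.vecMul_smul, mul_comm]
        using this
    -- The two linear relations, multiplied by the adjugate matrix and read at the coordinate `0`.
    have h1 := hmul u (fun j => v j * g) (signedAlternant_vecMul x)
    have h2 := hmul _ _ (removeFirst_signedAlternant_vecMul hx)
    have hd : removeFirst (x 0) (u 0) = 0 := by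
      rw [hu]
      exact removeFirst_alternant_of_forall_ne fun k h => Fin.succ_ne_zero k (hx h).symm
    have e1 : ∑ j, v j * g * M.adjugate j 0 = g * ∑ j, v j * M.adjugate j 0 := by
      rw [Finset.mul_sum]
      exact Finset.sum_congr rfl fun j _ => by ring
    have e2 : ∑ j, ((if j = 0 then g else 0) - u 0 * v j) * M.adjugate j 0 =
        g * u 0 ^ 2 - u 0 * ∑ j, v j * M.adjugate j 0 := by
      simp only [sub_mul, Finset.sum_sub_distrib, ite_mul, zero_mul, Finset.sum_ite_eq',
        Finset.mem_univ, if_true, hadj, Finset.mul_sum, mul_assoc]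
    have h1' := h1.trans e1
    have h2' := h2.trans e2
    rw [hd, zero_mul] at h2'
    apply mul_left_cancel₀ (pow_ne_zero 2 hu0)
    linear_combination u 0 * h1' + g * h2'

theorem inv_eq_alternant (d : ℕ) : inv d = alternant (id : Fin d → Fin d) := by
  rw [alternant_eq_sum_perm]
  rfl

theorem two_pow_smul_det_twoLetterMatrix (d : ℕ) :
    (2 : ℝ) ^ d • (twoLetterMatrix d).det = inv d ^ 2 := by
  have h : twoWordMatrix (id : Fin d → Fin d) =
      algebraMap ℝ (ShuffleAlgebra d) 2 • twoLetterMatrix d := by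
    ext i j : 2
    simp only [twoWordMatrix, twoLetterMatrix, Matrix.of_apply, Matrix.smul_apply, id,
      algebraMap_smul]
  rw [inv_eq_alternant, ← det_twoWordMatrix Function.injective_id, h, Matrix.det_smul,
    Fintype.card_fin, ← map_pow, ← Algebra.smul_def]

end ShuffleAlgebra

/-! ### The signature is a character of the shuffle algebra -/

namespace ShuffleAlgebra

variable {d : ℕ}

theorem pairing_word (T : List (Fin d) → ℝ) (w : List (Fin d)) : pairing T (word w) = T w := by
  rw [pairing, word, Module.Basis.constr_basis]

end ShuffleAlgebra

namespace PathSignature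

open MeasureTheory Set ShuffleAlgebra
open scoped Interval

variable {d : ℕ} {X : ℝ → Fin d → ℝ}

theorem continuousAt_deriv_of_contDiffOn_Icc {f : ℝ → ℝ} {a b x : ℝ}
    (hf : ContDiffOn ℝ 1 f (Icc a b)) (hx : x ∈ Ioo a b) : ContinuousAt (deriv f) x :=
  ((hf.mono Ioo_subset_Icc_self).continuousOn_deriv_of_isOpen isOpen_Ioo le_rfl).continuousAt
    (isOpen_Ioo.mem_nhds hx)

theorem intervalIntegrable_deriv_of_contDiffOn_Icc {f : ℝ → ℝ} {a b : ℝ} (hab : a < b)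
    (hf : ContDiffOn ℝ 1 f (Icc a b)) : IntervalIntegrable (deriv f) volume a b := by
  have h := (hf.continuousOn_derivWithin (uniqueDiffOn_Icc hab) le_rfl)
  rw [← uIcc_of_le hab.le] at h
  refine h.intervalIntegrable.congr_ae ?_
  rw [uIoc_of_le hab.le, ← restrict_Ioo_eq_restrict_Ioc]
  refine (ae_restrict_iff' measurableSet_Ioo).2 (Filter.Eventually.of_forall fun x hx => ?_)
  rw [uIcc_of_le hab.le]
  exact derivWithin_of_mem_nhds (Icc_mem_nhds hx.1 hx.2)

/-- The velocity of a piecewise smooth path is integrable. -/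
theorem IsPiecewiseSmooth.intervalIntegrable_deriv (hX : IsPiecewiseSmooth X) (a : Fin d) :
    IntervalIntegrable (deriv fun r => X r a) volume 0 1 := by
  obtain ⟨-, n, t, ht, ht0, ht1, hC⟩ := hX
  have key (i : Fin (n + 1)) : IntervalIntegrable (deriv fun r => X r a) volume 0 (t i) := by
    induction i using Fin.induction with
    | zero => rw [ht0]
    | succ i ih =>
      exact ih.trans (intervalIntegrable_deriv_of_contDiffOn_Icc (ht i.castSucc_lt_succ)
        (contDiffOn_pi.1 (hC i) a))
  exact ht1 ▸ key (Fin.last n)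

/-- The velocity of a piecewise smooth path is continuous outside a countable set. -/
theorem IsPiecewiseSmooth.exists_countable_continuousAt_deriv (hX : IsPiecewiseSmooth X) :
    ∃ s : Set ℝ, s.Countable ∧ ∀ x ∈ Ioo (0 : ℝ) 1 \ s, ∀ a,
      ContinuousAt (deriv fun r => X r a) x := by
  obtain ⟨-, n, t, ht, ht0, ht1, hC⟩ := hX
  refine ⟨range t, countable_range t, fun x hx a => ?_⟩
  have key (i : Fin (n + 1)) (hi : x < t i) : ContinuousAt (deriv fun r => X r a) x := by
    induction i using Fin.induction with
    | zero => exact absurd hx.1.1 (by linarith)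
    | succ i ih =>
      rcases lt_trichotomy x (t i.castSucc) with h | h | h
      · exact ih h
      · exact absurd ⟨_, h.symm⟩ hx.2
      · exact continuousAt_deriv_of_contDiffOn_Icc (contDiffOn_pi.1 (hC i) a) ⟨h, hi⟩
  exact key (Fin.last n) (ht1 ▸ hx.1.2)

theorem IsPiecewiseSmooth.continuousOn_iteratedIntegral (hX : IsPiecewiseSmooth X)
    (w : List (Fin d)) : ContinuousOn (iteratedIntegral X w) (Icc 0 1) := by
  induction w with
  | nil => exact continuousOn_const
  | cons a w ih =>
    have h : IntervalIntegrable (fun s => iteratedIntegral X w s * deriv (fun r => X r a) s)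
        volume 0 1 :=
      (hX.intervalIntegrable_deriv a).continuousOn_mul (by rwa [uIcc_of_le zero_le_one])
    rw [intervalIntegrable_iff_integrableOn_Icc_of_le zero_le_one,
      ← uIcc_of_le zero_le_one] at h
    change ContinuousOn
      (fun t => ∫ s in (0 : ℝ)..t, iteratedIntegral X w s * deriv (fun r => X r a) s) _
    simpa only [uIcc_of_le zero_le_one] using intervalIntegral.continuousOn_primitive_interval h

/-- The pairing with the signature of the restriction of `X` to `[0, t]`. -/
def partialPairing (X : ℝ → Fin d → ℝ) (t : ℝ) : ShuffleAlgebra d →ₗ[ℝ] ℝ :=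
  pairing fun w => iteratedIntegral X w.reverse t

theorem partialPairing_word_snoc (w : List (Fin d)) (a : Fin d) (t : ℝ) :
    partialPairing X t (word (w ++ [a])) =
      ∫ s in (0 : ℝ)..t, partialPairing X s (word w) * deriv (fun r => X r a) s := by
  simp [partialPairing, pairing_word, iteratedIntegral]

theorem IsPiecewiseSmooth.continuousOn_partialPairing (hX : IsPiecewiseSmooth X)
    (p : ShuffleAlgebra d) : ContinuousOn (fun t => partialPairing X t p) (Icc 0 1) := by
  induction p using induction_words with
  | h0 => simpa using continuousOn_const
  | hadd p q hp hq => simpa using hp.fun_add hq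
  | hsmul c p hp => simpa using continuousOn_const.fun_mul hp
  | hw w => simpa [partialPairing, pairing_word] using hX.continuousOn_iteratedIntegral w.reverse

theorem IsPiecewiseSmooth.intervalIntegrable_partialPairing (hX : IsPiecewiseSmooth X)
    (p : ShuffleAlgebra d) (a : Fin d) {t : ℝ} (ht : t ∈ Icc (0 : ℝ) 1) :
    IntervalIntegrable (fun s => partialPairing X s p * deriv (fun r => X r a) s) volume 0 t := by
  have h : IntervalIntegrable (fun s => partialPairing X s p * deriv (fun r => X r a) s)
      volume 0 1 :=
    (hX.intervalIntegrable_deriv a).continuousOn_mul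
      (by simpa only [uIcc_of_le zero_le_one] using hX.continuousOn_partialPairing p)
  exact h.mono_set (by
    rw [uIcc_of_le ht.1, uIcc_of_le zero_le_one]; exact Icc_subset_Icc_right ht.2)

theorem IsPiecewiseSmooth.partialPairing_snocLetter (hX : IsPiecewiseSmooth X)
    (p : ShuffleAlgebra d) (a : Fin d) {t : ℝ} (ht : t ∈ Icc (0 : ℝ) 1) :
    partialPairing X t (snocLetter a p) =
      ∫ s in (0 : ℝ)..t, partialPairing X s p * deriv (fun r => X r a) s := by
  induction p using induction_words with
  | h0 => simp
  | hadd p q hp hq =>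
    simp only [map_add, add_mul, hp, hq]
    rw [intervalIntegral.integral_add (hX.intervalIntegrable_partialPairing p a ht)
      (hX.intervalIntegrable_partialPairing q a ht)]
  | hsmul c p hp =>
    simp only [map_smul, hp, smul_eq_mul, mul_assoc, intervalIntegral.integral_const_mul]
  | hw w => rw [snocLetter_word, partialPairing_word_snoc]

theorem IsPiecewiseSmooth.exists_countable_hasDerivAt (hX : IsPiecewiseSmooth X) :
    ∃ s : Set ℝ, s.Countable ∧ ∀ x ∈ Ioo (0 : ℝ) 1 \ s, ∀ (w : List (Fin d)) (a : Fin d),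
      HasDerivAt (fun t => partialPairing X t (word (w ++ [a])))
        (partialPairing X x (word w) * deriv (fun r => X r a) x) x := by
  obtain ⟨s, hs, hc⟩ := hX.exists_countable_continuousAt_deriv
  refine ⟨s, hs, fun x hx w a => ?_⟩
  simp only [partialPairing_word_snoc]
  have hx' : x ∈ Icc (0 : ℝ) 1 := Ioo_subset_Icc_self hx.1
  refine intervalIntegral.integral_hasDerivAt_right
    (hX.intervalIntegrable_partialPairing _ a hx') ?_ ?_
  · refine AEStronglyMeasurable.stronglyMeasurableAtFilter_of_mem (s := Ioc 0 1) ?_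
      (Ioc_mem_nhds hx.1.1 hx.1.2)
    exact (hX.intervalIntegrable_partialPairing (word w) a
      (right_mem_Icc.2 zero_le_one)).1.aestronglyMeasurable
  · exact ((hX.continuousOn_partialPairing (word w)).continuousAt
      (Icc_mem_nhds hx.1.1 hx.1.2)).mul (hc x hx a)

/-- Integration by parts, which is the shuffle relation for words with the given last letters. -/
theorem IsPiecewiseSmooth.partialPairing_mul_partialPairing (hX : IsPiecewiseSmooth X)
    (v w : List (Fin d)) (a b : Fin d) {t : ℝ} (ht : t ∈ Icc (0 : ℝ) 1) :
    partialPairing X t (word (v ++ [a])) * partialPairing X t (word (w ++ [b])) =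
      (∫ s in (0 : ℝ)..t, partialPairing X s (word v) * partialPairing X s (word (w ++ [b])) *
        deriv (fun r => X r a) s) +
      ∫ s in (0 : ℝ)..t, partialPairing X s (word (v ++ [a])) * partialPairing X s (word w) *
        deriv (fun r => X r b) s := by
  obtain ⟨s, hs, hd⟩ := hX.exists_countable_hasDerivAt
  have hsub : Icc 0 t ⊆ Icc (0 : ℝ) 1 := Icc_subset_Icc_right ht.2
  have hcont (p : ShuffleAlgebra d) : ContinuousOn (fun t => partialPairing X t p) (uIcc 0 t) := by
    rw [uIcc_of_le ht.1]
    exact (hX.continuousOn_partialPairing p).mono hsub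
  have h1 : IntervalIntegrable (fun s => partialPairing X s (word v) *
      partialPairing X s (word (w ++ [b])) * deriv (fun r => X r a) s) volume 0 t :=
    ((hX.intervalIntegrable_partialPairing (word v) a ht).continuousOn_mul
      (hcont (word (w ++ [b])))).congr fun s _ => by ring
  have h2 : IntervalIntegrable (fun s => partialPairing X s (word (v ++ [a])) *
      partialPairing X s (word w) * deriv (fun r => X r b) s) volume 0 t :=
    ((hX.intervalIntegrable_partialPairing (word w) b ht).continuousOn_mul
      (hcont (word (v ++ [a])))).congr fun s _ => by ring
  rw [← intervalIntegral.integral_add h1 h2,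
    integral_eq_of_hasDerivAt_off_countable_of_le
      (fun t => partialPairing X t (word (v ++ [a])) * partialPairing X t (word (w ++ [b])))
      _ ht.1 hs _ _ (h1.add h2)]
  · simp [partialPairing_word_snoc]
  · have := (hcont (word (v ++ [a]))).mul (hcont (word (w ++ [b])))
    rwa [uIcc_of_le ht.1] at this
  · intro x hx
    have hx' : x ∈ Ioo (0 : ℝ) 1 \ s := ⟨⟨hx.1.1, hx.1.2.trans_le ht.2⟩, hx.2⟩
    refine ((hd x hx' v a).fun_mul (hd x hx' w b)).congr_deriv ?_
    ring

theorem partialPairing_one (X : ℝ → Fin d → ℝ) (t : ℝ) : partialPairing X t 1 = 1 := by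
  simp [partialPairing, one_def, pairing_word, iteratedIntegral]

theorem IsPiecewiseSmooth.partialPairing_word_mul_word (hX : IsPiecewiseSmooth X)
    (v w : List (Fin d)) {t : ℝ} (ht : t ∈ Icc (0 : ℝ) 1) :
    partialPairing X t (word v * word w) =
      partialPairing X t (word v) * partialPairing X t (word w) := by
  rcases List.eq_nil_or_concat' v with rfl | ⟨v, a, rfl⟩
  · rw [← one_def, one_mul, partialPairing_one, one_mul]
  rcases List.eq_nil_or_concat' w with rfl | ⟨w, b, rfl⟩
  · rw [← one_def, mul_one, partialPairing_one, mul_one]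
  have hmem {s : ℝ} (hs : s ∈ uIcc 0 t) : s ∈ Icc (0 : ℝ) 1 := by
    rw [uIcc_of_le ht.1] at hs
    exact Icc_subset_Icc_right ht.2 hs
  rw [word_snoc_mul_word_snoc, map_add, hX.partialPairing_snocLetter _ _ ht,
    hX.partialPairing_snocLetter _ _ ht, hX.partialPairing_mul_partialPairing v w a b ht]
  congr 1
  · exact intervalIntegral.integral_congr fun s hs => by
      simp only [hX.partialPairing_word_mul_word v (w ++ [b]) (hmem hs)]
  · exact intervalIntegral.integral_congr fun s hs => by
      simp only [hX.partialPairing_word_mul_word (v ++ [a]) w (hmem hs)]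
termination_by v.length + w.length
decreasing_by all_goals simp_wf; all_goals grind

theorem IsPiecewiseSmooth.pairing_signature_mul (hX : IsPiecewiseSmooth X)
    (p q : ShuffleAlgebra d) :
    pairing (signature X) (p * q) = pairing (signature X) p * pairing (signature X) q := by
  induction p using induction_words with
  | h0 => simp
  | hadd p p' hp hp' => simp only [map_add, add_mul, hp, hp']
  | hsmul c p hp => simp only [map_smul, smul_mul_assoc, hp]
  | hw v =>
    induction q using induction_words with
    | h0 => simp
    | hadd q q' hq hq' => simp only [map_add, mul_add, hq, hq']
    | hsmul c q hq => simp only [map_smul, mul_smul_comm, hq]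
    | hw w => exact hX.partialPairing_word_mul_word v w (right_mem_Icc.2 zero_le_one)

/-- The pairing with the signature, as a homomorphism of algebras. -/
def IsPiecewiseSmooth.signatureHom (hX : IsPiecewiseSmooth X) : ShuffleAlgebra d →ₐ[ℝ] ℝ :=
  AlgHom.ofLinearMap (pairing (signature X)) (partialPairing_one X 1) hX.pairing_signature_mul

theorem IsPiecewiseSmooth.signatureHom_apply (hX : IsPiecewiseSmooth X) (p : ShuffleAlgebra d) :
    hX.signatureHom p = pairing (signature X) p :=
  rfl

theorem IsPiecewiseSmooth.two_pow_mul_det_signatureMatrix (hX : IsPiecewiseSmooth X) :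
    (2 : ℝ) ^ d * (signatureMatrix X).det = pairing (signature X) (ShuffleAlgebra.inv d) ^ 2 := by
  have h : hX.signatureHom.mapMatrix (twoLetterMatrix d) = signatureMatrix X := by
    ext i j
    exact pairing_word _ _
  rw [← h, ← AlgHom.map_det, ← smul_eq_mul, ← map_smul, two_pow_smul_det_twoLetterMatrix, map_pow,
    hX.signatureHom_apply]

end PathSignature

end

theorem mainTheorem8 (d : ℕ) :
    (2 : ℝ) ^ d • (ShuffleAlgebra.twoLetterMatrix d).det = (ShuffleAlgebra.inv d) ^ 2 ∧
    ∀ X : ℝ → Fin d → ℝ, PathSignature.IsPiecewiseSmooth X →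
      (2 : ℝ) ^ d * (PathSignature.signatureMatrix X).det =
          (ShuffleAlgebra.pairing (PathSignature.signature X) (ShuffleAlgebra.inv d)) ^ 2 ∧
        IsSquare (PathSignature.signatureMatrix X).det ∧
        0 ≤ (PathSignature.signatureMatrix X).det := by
  refine ⟨ShuffleAlgebra.two_pow_smul_det_twoLetterMatrix d, fun X hX => ?_⟩
  have h := hX.two_pow_mul_det_signatureMatrix
  have h0 : 0 ≤ (PathSignature.signatureMatrix X).det :=
    nonneg_of_mul_nonneg_right (h ▸ sq_nonneg _) (by positivity)
  exact ⟨h, ⟨_, (Real.mul_self_sqrt h0).symm⟩, h0⟩
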